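/- Let $K$ be a commutative ring and let $R$ be a unital associative $K$-algebra (for $K=\mathbb{Z}$: an arbitrary unital ring). Suppose that $R$ is semiprime (that is, $aRa=0$ implies $a=0$ for $a\in R$) and left Goldie (that is, $R$ contains no infinite direct sum of nonzero left ideals and satisfies the ascending chain condition on left annihilators of subsets). Let ${\cal C}_R$ be the set of regular elements of $R$, i.e. the elements $c\in R$ such that for all $x\in R$, $cx=0$ implies $x=0$ and $xc=0$ implies $x=0$. A subset $S\subseteq R$ is called an Ore set of $R$ if it is multiplicative ($1\in S$, $SS\subseteq S$, $0\notin S$) and $Sr\cap Rs\neq\emptyset$ and $rS\cap sR\neq\emptyset$ for all $r\in R$ and $s\in S$. For a multiplicative set $S$, let $R\langle X_S\rangle$ be the $K$-algebra freely generated by the $K$-algebra $R$ and the set $X_S=\{x_s\mid s\in S\}$ of noncommuting indeterminates, let $I_S$ be its two-sided ideal generated by the elements $sx_s-1$ and $x_ss-1$ for $s\in S$, and let $R\langle S^{-1}\rangle=R\langle X_S\rangle/I_S$. Denote by ${\rm ass}_R(S)$ the kernel of the ring homomorphism $R\to R\langle S^{-1}\rangle$, $r\mapsto r+I_S$. Then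 ${\cal C}_R\cap {\rm ass}_R(S)=\emptyset$ for every Ore set $S$ of $R$. -/

import Mathlib

/-- A ring is semiprime if `a R a = 0` implies `a = 0`. -/
def IsSemiprimeRing (R : Type*) [Ring R] : Prop :=
  ∀ a : R, (∀ r : R, a * r * a = 0) → a = 0

/-- The left annihilator `{r | r x = 0 for all x ∈ X}` of a subset `X` of a ring, a left ideal. -/
def leftAnnihilator {R : Type*} [Ring R] (X : Set R) : Submodule R R where
  carrier := {r | ∀ x ∈ X, r * x = 0}
  add_mem' := by
    intro a b ha hb x hx
    rw [add_mul, ha x hx, hb x hx, add_zero]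
  zero_mem' := by
    intro x _
    exact zero_mul x
  smul_mem' := by
    intro c a ha x hx
    rw [smul_eq_mul, mul_assoc, ha x hx, mul_zero]

/-- A left Goldie ring: it contains no infinite direct sum of nonzero left ideals (that is, its
left uniform dimension is finite), and every ascending chain of left annihilators of subsets
stabilizes. -/
structure IsLeftGoldieRing (R : Type*) [Ring R] : Prop where
  finite_udim : ∀ I : ℕ → Submodule R R, iSupIndep I → ∃ n, I n = ⊥
  acc_leftAnnihilator : ∀ X : ℕ → Set R, Monotone (fun n => leftAnnihilator (X n)) →
    ∃ n, ∀ m, n ≤ m → leftAnnihilator (X m) = leftAnnihilator (X n)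

/-- An Ore set of a ring: a multiplicative set (a submonoid that does not contain `0`) which
satisfies the left Ore condition `S r ∩ R s ≠ ∅` and the right Ore condition `r S ∩ s R ≠ ∅`
for all `r ∈ R` and `s ∈ S`. -/
structure IsOreSet {R : Type*} [Ring R] (S : Submonoid R) : Prop where
  zero_notMem : (0 : R) ∉ S
  left_ore : ∀ r : R, ∀ s ∈ S, ∃ s' ∈ S, ∃ r' : R, s' * r = r' * s
  right_ore : ∀ r : R, ∀ s ∈ S, ∃ s' ∈ S, ∃ r' : R, r * s' = s * r'

/-- The relations which say that the generators `Sum.inl r`, `r ∈ R`, form a copy of the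
`K`-algebra `R`. The generators `Sum.inr x`, `x ∈ X`, are subject to no relation. -/
inductive FreeExtensionRel (K R X : Type*) [CommRing K] [Ring R] [Algebra K R] :
    FreeAlgebra K (R ⊕ X) → FreeAlgebra K (R ⊕ X) → Prop
  | add (a b : R) : FreeExtensionRel K R X (FreeAlgebra.ι K (Sum.inl (a + b)))
      (FreeAlgebra.ι K (Sum.inl a) + FreeAlgebra.ι K (Sum.inl b))
  | mul (a b : R) : FreeExtensionRel K R X (FreeAlgebra.ι K (Sum.inl (a * b)))
      (FreeAlgebra.ι K (Sum.inl a) * FreeAlgebra.ι K (Sum.inl b))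
  | algebraMap (k : K) : FreeExtensionRel K R X
      (FreeAlgebra.ι K (Sum.inl (algebraMap K R k))) (algebraMap K (FreeAlgebra K (R ⊕ X)) k)

/-- `R⟨X⟩`, the `K`-algebra freely generated by the `K`-algebra `R` and a set `X` of
noncommutative indeterminates. -/
abbrev FreeExtension (K R X : Type*) [CommRing K] [Ring R] [Algebra K R] :=
  RingQuot (FreeExtensionRel K R X)

/-- The canonical homomorphism `R → R⟨X⟩`. -/
noncomputable def FreeExtension.incl (K R X : Type*) [CommRing K] [Ring R] [Algebra K R] :
    R →ₐ[K] FreeExtension K R X :=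
  AlgHom.ofLinearMap
    { toFun := fun r => RingQuot.mkAlgHom K (FreeExtensionRel K R X) (FreeAlgebra.ι K (Sum.inl r))
      map_add' := fun a b => by
        rw [RingQuot.mkAlgHom_rel K (FreeExtensionRel.add a b), map_add]
      map_smul' := fun k a => by
        rw [Algebra.smul_def, RingQuot.mkAlgHom_rel K (FreeExtensionRel.mul _ a), map_mul,
          RingQuot.mkAlgHom_rel K (FreeExtensionRel.algebraMap k), AlgHom.commutes,
          RingHom.id_apply, Algebra.smul_def] }
    (by
      have h := RingQuot.mkAlgHom_rel K (FreeExtensionRel.algebraMap (K := K) (R := R) (X := X) 1)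
      simpa using h)
    (fun a b => by
      have h := RingQuot.mkAlgHom_rel K (FreeExtensionRel.mul (K := K) (X := X) a b)
      simpa using h)

/-- The indeterminate of `R⟨X⟩` with index `x`. -/
noncomputable def FreeExtension.var (K R : Type*) {X : Type*} [CommRing K] [Ring R] [Algebra K R]
    (x : X) : FreeExtension K R X :=
  RingQuot.mkAlgHom K (FreeExtensionRel K R X) (FreeAlgebra.ι K (Sum.inr x))

/-- The ideal `I_S` of `R⟨X_S⟩` generated by all `s x_s - 1` and `x_s s - 1` with `s ∈ S`. -/
noncomputable def inverseIdeal (K : Type*) {R : Type*} [CommRing K] [Ring R] [Algebra K R]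
    (S : Submonoid R) : TwoSidedIdeal (FreeExtension K R S) :=
  TwoSidedIdeal.span
    ({y | ∃ s : S, y = FreeExtension.incl K R S (s : R) * FreeExtension.var K R s - 1} ∪
      {y | ∃ s : S, y = FreeExtension.var K R s * FreeExtension.incl K R S (s : R) - 1})

/-- The ring `R⟨S⁻¹⟩ = R⟨X_S⟩ / I_S`. -/
abbrev UniversalLocalization (K : Type*) {R : Type*} [CommRing K] [Ring R] [Algebra K R]
    (S : Submonoid R) :=
  (inverseIdeal K S).ringCon.Quotient

/-- The canonical homomorphism `R → R⟨S⁻¹⟩`, `r ↦ r + I_S`. -/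
noncomputable def toUniversalLocalization (K : Type*) {R : Type*} [CommRing K] [Ring R]
    [Algebra K R] (S : Submonoid R) : R →ₐ[K] UniversalLocalization K S :=
  ((inverseIdeal K S).ringCon.mkₐ K).comp (FreeExtension.incl K R S)

/-- The ideal `ass_R(S)`, the kernel of `R → R⟨S⁻¹⟩`. -/
noncomputable def assIdeal (K : Type*) {R : Type*} [CommRing K] [Ring R] [Algebra K R]
    (S : Submonoid R) : TwoSidedIdeal R :=
  TwoSidedIdeal.ker (toUniversalLocalization K S)

/-! Any homomorphism inverting `S` kills `ass_R(S)`, so it suffices to build the Ore localization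
`S⁻¹R`: the kernel of `R → S⁻¹R` is left `S`-torsion, and `s * c = 0` with `c` regular would force
`s = 0 ∈ S`. `S⁻¹R` exists once right `S`-torsion is left `S`-torsion
(`IsOreSet.exists_mul_eq_zero`). The chain condition yields `t ∈ S` with maximal left annihilator;
the right Ore condition shows that this annihilator contains all right torsion, and semiprimeness
moves `t` to the left. -/

section FreeExtension

variable {K R : Type*} [CommRing K] [Ring R] [Algebra K R]

/-- The universal property of `R⟨X⟩`. -/
theorem FreeExtension.exists_lift {X T : Type*} [Ring T] [Algebra K T] (f : R →ₐ[K] T)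
    (g : X → T) : ∃ F : FreeExtension K R X →ₐ[K] T,
      (∀ r, F (FreeExtension.incl K R X r) = f r) ∧
      ∀ x, F (FreeExtension.var K R x) = g x := by
  refine ⟨RingQuot.liftAlgHom K ⟨FreeAlgebra.lift K (Sum.elim f g), ?_⟩, fun r => ?_,
    fun x => ?_⟩
  · rintro _ _ (⟨a, b⟩ | ⟨a, b⟩ | ⟨k⟩) <;> simp
  · exact (RingQuot.liftAlgHom_mkAlgHom_apply K _ _ _).trans (by simp)
  · exact (RingQuot.liftAlgHom_mkAlgHom_apply K _ _ _).trans (by simp)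

/-- An algebra homomorphism that inverts `S` vanishes on `ass_R(S)`. -/
theorem map_eq_zero_of_mem_assIdeal {T : Type*} [Ring T] [Algebra K T] {S : Submonoid R}
    (f : R →ₐ[K] T) (hf : ∀ s : S, IsUnit (f s)) {a : R} (ha : a ∈ assIdeal K S) : f a = 0 := by
  choose u hu using hf
  obtain ⟨F, hF, hFv⟩ := FreeExtension.exists_lift f (fun s : S => ((u s)⁻¹ : Tˣ).val)
  have hle : inverseIdeal K S ≤ TwoSidedIdeal.ker F := by
    refine TwoSidedIdeal.span_le.2 ?_
    rintro _ (⟨s, rfl⟩ | ⟨s, rfl⟩) <;>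
      simp [TwoSidedIdeal.mem_ker, hF, hFv, ← hu]
  have hmem : FreeExtension.incl K R S a ∈ inverseIdeal K S := by
    rw [TwoSidedIdeal.mem_iff]
    exact (RingCon.eq _).1 ((TwoSidedIdeal.mem_ker _).1 ha)
  rw [← hF]
  exact (TwoSidedIdeal.mem_ker _).1 (hle hmem)

end FreeExtension

section OreSet

variable {R : Type*} [Ring R] {S : Submonoid R}

/-- The left annihilators of elements of `S` have a maximal member. -/
theorem IsLeftGoldieRing.exists_maximal_leftAnnihilator (hG : IsLeftGoldieRing R)
    (S : Submonoid R) : ∃ t ∈ S, ∀ u ∈ S,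
      leftAnnihilator {t} ≤ leftAnnihilator {u} → leftAnnihilator {u} ≤ leftAnnihilator {t} := by
  have hwf : WellFoundedGT {N : Submodule R R // ∃ X : Set R, leftAnnihilator X = N} := by
    refine wellFoundedGT_iff_monotone_chain_condition.2 fun N => ?_
    choose X hX using fun n => (N n).2
    obtain ⟨n, hn⟩ := hG.acc_leftAnnihilator X fun i j hij => by
      change leftAnnihilator (X i) ≤ leftAnnihilator (X j)
      rw [hX, hX]
      exact N.monotone hij
    exact ⟨n, fun m hm => Subtype.ext (by rw [← hX, ← hX, hn m hm])⟩
  let f : S → {N : Submodule R R // ∃ X : Set R, leftAnnihilator X = N} :=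
    fun s => ⟨leftAnnihilator {(s : R)}, _, rfl⟩
  obtain ⟨_, ⟨t, rfl⟩, ht⟩ := hwf.wf.has_min (Set.range f) (Set.range_nonempty f)
  exact ⟨t, t.2, fun u hu h => by_contra fun hn => ht _ ⟨⟨u, hu⟩, rfl⟩ ⟨h, hn⟩⟩

/-- In a semiprime left Goldie ring, right torsion with respect to an Ore set is left torsion. -/
theorem IsOreSet.exists_mul_eq_zero (hS : IsOreSet S) (hsp : IsSemiprimeRing R)
    (hG : IsLeftGoldieRing R) : ∃ t ∈ S, ∀ r : R, ∀ u ∈ S, r * u = 0 → t * r = 0 := by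
  obtain ⟨t, ht, hmax⟩ := hG.exists_maximal_leftAnnihilator S
  have key : ∀ r : R, ∀ u ∈ S, r * u = 0 → r * t = 0 := by
    intro r u hu hru
    -- Since `t * v = u * r'`, `r` kills `t * v`, whose left annihilator contains that of `t`; by
    -- maximality they agree.
    obtain ⟨v, hv, r', h⟩ := hS.right_ore t u hu
    refine hmax (t * v) (S.mul_mem ht hv) ?_ (x := r) ?_ t rfl
    · rintro x hx _ rfl
      rw [← mul_assoc, hx t rfl, zero_mul]
    · rintro _ rfl
      rw [h, ← mul_assoc, hru, zero_mul]
  refine ⟨t, ht, fun r u hu hru => hsp _ fun x => ?_⟩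
  -- Right torsion is stable under right multiplication: `r * x * v = r * u * x' = 0`, so `key`
  -- applies to `r * x`.
  obtain ⟨v, hv, x', h⟩ := hS.right_ore x u hu
  have hrxt : r * x * t = 0 := key (r * x) v hv (by rw [mul_assoc, h, ← mul_assoc, hru, zero_mul])
  calc t * r * x * (t * r) = t * (r * x * t) * r := by simp only [mul_assoc]
    _ = 0 := by rw [hrxt, mul_zero, zero_mul]

/-- An Ore set of a semiprime left Goldie ring is a left denominator set. -/
theorem IsOreSet.nonempty_oreSet (hS : IsOreSet S) (hsp : IsSemiprimeRing R)
    (hG : IsLeftGoldieRing R) : Nonempty (OreLocalization.OreSet S) := by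
  obtain ⟨t, ht, h⟩ := hS.exists_mul_eq_zero hsp hG
  refine OreLocalization.nonempty_oreSet_iff.2 ⟨fun a b s hab => ⟨⟨t, ht⟩, ?_⟩, fun r s => ?_⟩
  · rw [← sub_eq_zero, ← mul_sub]
    exact h _ s s.2 (by rw [sub_mul, hab, sub_self])
  · obtain ⟨s', hs', r', h⟩ := hS.left_ore r s s.2
    exact ⟨r', ⟨s', hs'⟩, h⟩

/-- Elements of `ass_R(S)` are left torsion with respect to a left denominator set `S`. -/
theorem exists_mul_eq_zero_of_mem_assIdeal {K : Type*} [CommRing K] [Algebra K R]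
    [OreLocalization.OreSet S] {a : R} (ha : a ∈ assIdeal K S) : ∃ s ∈ S, s * a = 0 := by
  let f : R →ₐ[K] OreLocalization S R :=
    { OreLocalization.numeratorRingHom with commutes' := fun _ => rfl }
  have hfa : f a = 0 :=
    map_eq_zero_of_mem_assIdeal f (fun s => OreLocalization.numerator_isUnit s) ha
  have h0 : OreLocalization.oreDiv a (1 : S) = OreLocalization.oreDiv (0 : R) (1 : S) :=
    hfa.trans (OreLocalization.zero_def)
  -- Both denominators are `1`, so the multipliers `u` and `v` coincide and `u` kills `a`.
  obtain ⟨u, v, hua, huv⟩ := OreLocalization.oreDiv_eq_iff.1 h0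
  have hv : (u : R) = v := by simpa using huv
  exact ⟨u, u.2, by simpa [hv] using hua.symm⟩

end OreSet

theorem mainTheorem8 {K R : Type*} [CommRing K] [Ring R] [Algebra K R]
    (hsp : IsSemiprimeRing R) (hG : IsLeftGoldieRing R) (S : Submonoid R) (hS : IsOreSet S) :
    (nonZeroDivisors R : Set R) ∩ (assIdeal K S : Set R) = ∅ := by
  refine Set.eq_empty_of_forall_notMem fun c ⟨hc, hca⟩ => hS.zero_notMem ?_
  obtain ⟨_⟩ := hS.nonempty_oreSet hsp hG
  obtain ⟨s, hs, hsc⟩ := exists_mul_eq_zero_of_mem_assIdeal (K := K) hca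
  rwa [hc.2 s hsc] at hs
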